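/- Let $*$ be a continuous t-norm on $[0,1]$, i.e. $([0,1],*,1)$ is a commutative monoid, $*$ is monotone in both arguments, and $*\colon[0,1]\times[0,1]\to[0,1]$ is continuous; let $p\rightarrow q=\bigvee\{r\in[0,1]\mid p*r\leq q\}$ be its residuum. A $[0,1]_*$-set is a set $X$ with a map $\alpha\colon X\times X\to[0,1]$ such that, for all $x,y,z\in X$, $\alpha(x,y)\leq\alpha(x,x)\wedge\alpha(y,y)$, $\alpha(x,y)=\alpha(y,x)$, and $\alpha(y,z)*(\alpha(y,y)\rightarrow\alpha(x,y))\leq\alpha(x,z)$. It is separated if $\alpha(x,x)=\alpha(y,y)=\alpha(x,y)$ implies $x=y$. For $p\in[0,1]$, a singleton on $X$ of extent $p$ is a map $\lambda\colon X\to[0,1]$ such that, for all $y,y'\in X$, $$\lambda(y)\leq p\wedge\alpha(y,y),\quad (\alpha(y,y)\rightarrow\alpha(y,y'))*\lambda(y)\leq\lambda(y'),\quad \lambda(y')*(p\rightarrow\lambda(y))\leq\alpha(y,y'),\quad p\leq\bigvee_{z\in X}\lambda(z)*(\alpha(z,z)\rightarrow\lambda(z)).$$ $X$ is Cauchy complete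 if for every $p\in[0,1]$ and every singleton $\lambda$ on $X$ of extent $p$ there is $x\in X$ with $\lambda=\alpha(x,-)$. A monotone function $f\colon(X,\alpha)\to(Y,\beta)$ is a function $f\colon X\to Y$ with $\alpha(x,x)=\beta(fx,fx)$ and $\alpha(x,x')\leq\beta(fx,fx')$ for all $x,x'\in X$. Proposition. The category of separated Cauchy complete $[0,1]_*$-sets and monotone functions is cartesian closed (it has finite products, and for every object $Y$ the functor $-\times Y$ has a right adjoint) if and only if $*$ is the minimum t-norm, i.e. $p*q=\min\{p,q\}$ for all $p,q\in[0,1]$. -/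

import Mathlib

open CategoryTheory

universe u v w

/-- A continuous t-norm on the unit interval `[0,1]`. -/
structure ContTNorm where
  /-- the binary operation `p * q` -/
  op : unitInterval → unitInterval → unitInterval
  op_assoc : ∀ p q r, op (op p q) r = op p (op q r)
  op_comm : ∀ p q, op p q = op q p
  op_one : ∀ p, op p 1 = p
  op_mono : ∀ p p' q q', p ≤ p' → q ≤ q' → op p q ≤ op p' q'
  op_continuous : Continuous (fun x : unitInterval × unitInterval => op x.1 x.2)

namespace ContTNorm

/-- The residuum `p → q` of a continuous t-norm: the largest `r` with `p * r ≤ q`. -/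
noncomputable def imp (T : ContTNorm) (p q : unitInterval) : unitInterval :=
  sSup {r | T.op p r ≤ q}

theorem op_zero (T : ContTNorm) (p : unitInterval) : T.op p 0 = 0 := by
  apply le_antisymm _ bot_le
  calc T.op p 0 ≤ T.op 1 0 := T.op_mono _ _ _ _ le_top le_rfl
    _ = 0 := by rw [T.op_comm, T.op_one]

/-- The Galois connection that characterizes the residuum. -/
theorem op_le_iff_le_imp (T : ContTNorm) (p q r : unitInterval) :
    T.op p q ≤ r ↔ q ≤ T.imp p r := by
  refine ⟨fun h => le_sSup h, fun h => ?_⟩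
  have hne : {s | T.op p s ≤ r}.Nonempty := ⟨0, by simp [T.op_zero]⟩
  have hc : IsClosed {s | T.op p s ≤ r} :=
    isClosed_le (T.op_continuous.comp (by fun_prop : Continuous fun s => (p, s)))
      continuous_const
  exact (T.op_mono _ _ _ _ le_rfl h).trans (hc.sSup_mem hne)

/-- `T` is the minimum t-norm. -/
def IsMin (T : ContTNorm) : Prop := ∀ p q, T.op p q = p ⊓ q

end ContTNorm

/-- A `[0,1]_*`-set: a set `X` with a map `α : X × X → [0,1]` satisfying
strictness, symmetry and transitivity. -/
structure RSet (T : ContTNorm) where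
  /-- the underlying set -/
  carrier : Type u
  /-- the `[0,1]_*`-valued equality -/
  eqv : carrier → carrier → unitInterval
  eqv_le : ∀ x y, eqv x y ≤ eqv x x ⊓ eqv y y
  eqv_symm : ∀ x y, eqv x y = eqv y x
  eqv_trans : ∀ x y z, T.op (eqv y z) (T.imp (eqv y y) (eqv x y)) ≤ eqv x z

namespace RSet

variable {T : ContTNorm}

/-- The relation `x ≅ y`, i.e. `α(x,x) = α(y,y) = α(x,y)`. -/
def Equivalent (X : RSet.{u} T) (x y : X.carrier) : Prop :=
  X.eqv x x = X.eqv y y ∧ X.eqv y y = X.eqv x y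

/-- `X` is separated if `x ≅ y ↔ x = y`. -/
def IsSeparated (X : RSet.{u} T) : Prop :=
  ∀ x y : X.carrier, X.Equivalent x y ↔ x = y

/-- Morphisms `φ : X ⇸ Y` of `[0,1]_*`-sets. -/
structure IsMorphism (X : RSet.{u} T) (Y : RSet.{v} T)
    (φ : X.carrier → Y.carrier → unitInterval) : Prop where
  le : ∀ x y, φ x y ≤ X.eqv x x ⊓ Y.eqv y y
  congr : ∀ x x' y y',
    T.op (T.op (T.imp (Y.eqv y y) (Y.eqv y y')) (φ x y)) (T.imp (X.eqv x x) (X.eqv x' x))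
      ≤ φ x' y'
  functional : ∀ x y y', T.op (φ x y') (T.imp (X.eqv x x) (φ x y)) ≤ Y.eqv y y'
  total : ∀ x x', X.eqv x x' ≤ ⨆ y, T.op (φ x' y) (T.imp (Y.eqv y y) (φ x y))

/-- The one-element `[0,1]_*`-set `{p}` whose element has extent of existence `p`. -/
def one (T : ContTNorm) (p : unitInterval) : RSet.{0} T where
  carrier := Unit
  eqv _ _ := p
  eqv_le _ _ := by simp
  eqv_symm _ _ := rfl
  eqv_trans _ _ _ :=
    (T.op_mono _ _ _ _ le_rfl le_top).trans (T.op_one p).le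

/-- A singleton on `X` with extent `p`: a morphism `{p} ⇸ X`. -/
def IsSingleton (X : RSet.{u} T) (p : unitInterval) (l : X.carrier → unitInterval) : Prop :=
  IsMorphism (one T p) X (fun _ => l)

/-- `X` is Cauchy complete if every singleton on `X` is of the form `α(x,-)`. -/
def IsCauchyComplete (X : RSet.{u} T) : Prop :=
  ∀ (p : unitInterval) (l : X.carrier → unitInterval), X.IsSingleton p l →
    ∃ x, l = X.eqv x

/-- Monotone functions of `[0,1]_*`-sets. -/
@[ext]
structure MonoFun (X : RSet.{u} T) (Y : RSet.{v} T) where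
  /-- the underlying function -/
  toFun : X.carrier → Y.carrier
  extent : ∀ x, X.eqv x x = Y.eqv (toFun x) (toFun x)
  mono : ∀ x x', X.eqv x x' ≤ Y.eqv (toFun x) (toFun x')

/-- The identity monotone function. -/
def MonoFun.id (X : RSet.{u} T) : MonoFun X X where
  toFun x := x
  extent _ := rfl
  mono _ _ := le_rfl

/-- Composition of monotone functions: first `f`, then `g`. -/
def MonoFun.comp {X : RSet.{u} T} {Y : RSet.{v} T} {Z : RSet.{w} T}
    (f : MonoFun X Y) (g : MonoFun Y Z) : MonoFun X Z where
  toFun x := g.toFun (f.toFun x)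
  extent x := (f.extent x).trans (g.extent _)
  mono x x' := (f.mono x x').trans (g.mono _ _)

/-- The category of `[0,1]_*`-sets and monotone functions. -/
instance : Category (RSet.{u} T) where
  Hom X Y := MonoFun X Y
  id X := MonoFun.id X
  comp f g := MonoFun.comp f g

end RSet

/-- The property of being separated and Cauchy complete. -/
def isSepCauchyComplete (T : ContTNorm) : ObjectProperty (RSet.{u} T) :=
  fun X => X.IsSeparated ∧ X.IsCauchyComplete

/-- The category of separated Cauchy complete `[0,1]_*`-sets and monotone functions, as a
full subcategory of the category of `[0,1]_*`-sets and monotone functions. -/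
abbrev CcRSet (T : ContTNorm) : Type (u + 1) := (isSepCauchyComplete.{u} T).FullSubcategory

/-- `C` is cartesian closed: it has finite products, and taking the product with any fixed
object has a right adjoint. -/
def IsCartesianClosed (C : Type u) [Category.{v} C] : Prop :=
  ∃ _ : CartesianMonoidalCategory C, Nonempty (MonoidalClosed C)

/-!
If `*` is the minimum, a `[0,1]_*`-set behaves like a set varying over `[0,1]`: elements of a Cauchy
complete one can be restricted to smaller extents, and the exponential of `A` and `Y` consists of
the monotone functions defined on the part of `A` up to a given extent.

Conversely, let `B × -` have a right adjoint. Families of maps on `B` indexed by `A` that agree at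
`x ∈ A` have transposes that agree at `x`, so transitivity in the exponential compares the one at
`a` with the other at `a'`. Applied, for `A` and `B` of full extent, to distances on `B × A` with
values in `[0,1]`, this yields the interpolation inequality
`β(b,b') ∧ (α(a,x) * α(x,a')) ≤ ⋁ c, (β(b,c) ∧ α(a,x)) * (β(c,b') ∧ α(x,a'))`.
For the two-point sets `A` and `B` with degrees of equality `t` and `t * t` it reads
`t * t ≤ t * (t * t)`. By continuity every `p` is of the form `t * t`, hence idempotent, and a
t-norm all of whose elements are idempotent is the minimum.
-/

open ContTNorm

namespace ContTNorm

variable (T : ContTNorm) {p p' q q' r : unitInterval}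

instance : Std.Associative T.op := ⟨T.op_assoc⟩

instance : Std.Commutative T.op := ⟨T.op_comm⟩

theorem one_op (p : unitInterval) : T.op 1 p = p := by rw [T.op_comm, T.op_one]

variable {T} in
@[gcongr]
theorem op_le_op (hp : p ≤ p') (hq : q ≤ q') : T.op p q ≤ T.op p' q' :=
  T.op_mono _ _ _ _ hp hq

theorem op_le_left (p q : unitInterval) : T.op p q ≤ p :=
  (op_le_op le_rfl le_top).trans (T.op_one p).le

theorem op_le_right (p q : unitInterval) : T.op p q ≤ q :=
  T.op_comm p q ▸ T.op_le_left q p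

theorem gc_op_imp (p : unitInterval) : GaloisConnection (T.op p) (T.imp p) :=
  T.op_le_iff_le_imp p

theorem op_imp_le (p q : unitInterval) : T.op p (T.imp p q) ≤ q :=
  (T.gc_op_imp p).l_u_le q

variable {T} in
@[gcongr]
theorem imp_le_imp_left (h : q ≤ q') : T.imp p q ≤ T.imp p q' :=
  (T.gc_op_imp p).monotone_u h

variable {T} in
theorem imp_eq_one (h : p ≤ q) : T.imp p q = 1 :=
  top_le_iff.1 ((T.op_le_iff_le_imp p 1 q).1 ((T.op_one p).trans_le h))

theorem one_imp (p : unitInterval) : T.imp 1 p = p :=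
  le_antisymm (T.one_op (T.imp 1 p) ▸ T.op_imp_le 1 p)
    ((T.op_le_iff_le_imp 1 p p).1 (T.one_op p).le)

theorem op_iSup {ι : Sort*} (p : unitInterval) (f : ι → unitInterval) :
    T.op p (⨆ i, f i) = ⨆ i, T.op p (f i) :=
  (T.gc_op_imp p).l_iSup

theorem iSup_op {ι : Sort*} (p : unitInterval) (f : ι → unitInterval) :
    T.op (⨆ i, f i) p = ⨆ i, T.op (f i) p := by
  simp only [T.op_comm _ p, T.op_iSup]

variable {T} in
theorem imp_op_le_imp (h : T.op q r ≤ q') : T.op (T.imp p q) r ≤ T.imp p q' := by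
  rw [← T.op_le_iff_le_imp, ← T.op_assoc]
  exact (op_le_op (T.op_imp_le p q) le_rfl).trans h

theorem continuous_op_left (p : unitInterval) : Continuous (T.op p) :=
  T.op_continuous.comp (Continuous.prodMk_right p)

variable {T} in
/-- Divisibility: by the intermediate value theorem `T.op p` attains every value below `p`. -/
theorem op_imp_of_le (h : q ≤ p) : T.op p (T.imp p q) = q := by
  obtain ⟨r, hr⟩ := mem_range_of_exists_le_of_exists_ge (T.continuous_op_left p)
    ⟨0, (T.op_zero p).trans_le bot_le⟩ ⟨1, h.trans (T.op_one p).ge⟩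
  refine le_antisymm (T.op_imp_le p q) ?_
  calc q = T.op p r := hr.symm
    _ ≤ T.op p (T.imp p q) := by
      gcongr
      exact (T.op_le_iff_le_imp p r q).1 hr.le

variable {T} in
theorem op_imp_left_comm (hq : q ≤ p) (hr : r ≤ p) : T.op q (T.imp p r) = T.op r (T.imp p q) := by
  calc T.op q (T.imp p r) = T.op (T.op p (T.imp p q)) (T.imp p r) := by rw [op_imp_of_le hq]
    _ = T.op (T.op p (T.imp p r)) (T.imp p q) := by ac_rfl
    _ = T.op r (T.imp p q) := by rw [op_imp_of_le hr]

theorem exists_op_self_eq (p : unitInterval) : ∃ t, T.op t t = p :=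
  mem_range_of_exists_le_of_exists_ge (T.op_continuous.comp (continuous_id.prodMk continuous_id))
    ⟨0, (T.op_zero 0).trans_le bot_le⟩ ⟨1, le_top.trans (T.op_one 1).ge⟩

variable {T} in
theorem isMin_of_op_self_le (h : ∀ t, T.op t t ≤ T.op t (T.op t t)) : T.IsMin := by
  have le_op_self (p : unitInterval) : p ≤ T.op p p := by
    obtain ⟨t, rfl⟩ := T.exists_op_self_eq p
    calc T.op t t ≤ T.op t (T.op t t) := h t
      _ ≤ T.op t (T.op t (T.op t t)) := op_le_op le_rfl (h t)
      _ = T.op (T.op t t) (T.op t t) := by ac_rfl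
  intro p q
  refine le_antisymm (le_inf (T.op_le_left p q) (T.op_le_right p q)) ?_
  calc p ⊓ q ≤ T.op (p ⊓ q) (p ⊓ q) := le_op_self _
    _ ≤ T.op p q := by gcongr <;> simp

end ContTNorm

namespace RSet

variable {T : ContTNorm}

instance : CoeSort (RSet.{u} T) (Type u) := ⟨carrier⟩

instance {X : RSet.{u} T} {Y : RSet.{v} T} : CoeFun (MonoFun X Y) fun _ => X → Y :=
  ⟨MonoFun.toFun⟩

section Basic

variable {X : RSet.{u} T}

theorem eqv_le_left (X : RSet.{u} T) (x y : X) : X.eqv x y ≤ X.eqv x x :=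
  (X.eqv_le x y).trans inf_le_left

theorem eqv_le_right (X : RSet.{u} T) (x y : X) : X.eqv x y ≤ X.eqv y y :=
  (X.eqv_le x y).trans inf_le_right

theorem eqv_op_imp_le (X : RSet.{u} T) (x y z : X) :
    T.op (X.eqv x y) (T.imp (X.eqv y y) (X.eqv y z)) ≤ X.eqv x z := by
  simpa only [X.eqv_symm y x, X.eqv_symm z] using X.eqv_trans z y x

theorem isSeparated_iff : X.IsSeparated ↔ ∀ x y, X.Equivalent x y → x = y :=
  forall₂_congr fun _ _ => ⟨Iff.mp, fun h => ⟨h, by rintro rfl; exact ⟨rfl, rfl⟩⟩⟩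

theorem Equivalent.eqv_eq {x y : X} (h : X.Equivalent x y) : X.eqv x = X.eqv y := by
  have eqv_le_eqv {x y : X} (h : X.Equivalent x y) (z : X) : X.eqv x z ≤ X.eqv y z := by
    simpa only [imp_eq_one (h.1.trans (h.2.trans (X.eqv_symm x y))).le, T.op_one]
      using X.eqv_trans y x z
  have symm : X.Equivalent y x := ⟨h.1.symm, by rw [h.1, h.2, X.eqv_symm]⟩
  exact funext fun z => le_antisymm (eqv_le_eqv h z) (eqv_le_eqv symm z)

theorem IsSeparated.eq (h : X.IsSeparated) {p : unitInterval} {x y : X} (hx : X.eqv x x = p)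
    (hy : X.eqv y y = p) (hxy : p ≤ X.eqv x y) : x = y :=
  (h x y).1 ⟨hx.trans hy.symm, le_antisymm (hy.trans_le hxy) (X.eqv_le_right x y)⟩

theorem MonoFun.eqv_apply_self {X : RSet.{u} T} {Y : RSet.{v} T} (f : MonoFun X Y) (x : X) :
    Y.eqv (f x) (f x) = X.eqv x x :=
  (f.extent x).symm

end Basic

section Extensional

variable {X : RSet.{u} T} {Y : RSet.{v} T} {l m : X → unitInterval}

/-- Extensional maps, the `[0,1]_*`-valued subsets of `X`: the maps `l` below the extent of
existence that respect the equality of `X`. -/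
structure IsExtensional (X : RSet.{u} T) (l : X → unitInterval) : Prop where
  le_eqv : ∀ x, l x ≤ X.eqv x x
  op_imp_le : ∀ x y, T.op (l x) (T.imp (X.eqv x x) (X.eqv x y)) ≤ l y

theorem isExtensional_eqv (x : X) : X.IsExtensional (X.eqv x) where
  le_eqv := X.eqv_le_right x
  op_imp_le := X.eqv_op_imp_le x

namespace IsExtensional

theorem eqv_op_imp_le (hl : X.IsExtensional l) (x y : X) :
    T.op (X.eqv x y) (T.imp (X.eqv x x) (l x)) ≤ l y := by
  rw [op_imp_left_comm (X.eqv_le_left x y) (hl.le_eqv x)]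
  exact hl.op_imp_le x y

theorem iSup_op {ι : Sort*} (c : ι → unitInterval) {l : ι → X → unitInterval}
    (hl : ∀ i, X.IsExtensional (l i)) : X.IsExtensional fun x => ⨆ i, T.op (c i) (l i x) where
  le_eqv x := iSup_le fun i => (T.op_le_right _ _).trans ((hl i).le_eqv x)
  op_imp_le x y := by
    rw [T.iSup_op]
    refine iSup_mono fun i => ?_
    rw [T.op_assoc]
    gcongr
    exact (hl i).op_imp_le x y

theorem comp {m : Y → unitInterval} (hm : Y.IsExtensional m) (f : MonoFun X Y) :
    X.IsExtensional fun x => m (f x) where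
  le_eqv x := (hm.le_eqv (f x)).trans (f.extent x).ge
  op_imp_le x y := by
    rw [f.extent]
    exact (op_le_op le_rfl (imp_le_imp_left (f.mono x y))).trans (hm.op_imp_le (f x) (f y))

end IsExtensional

/-- The degree to which `l` and `m` have an element in common, in the sense of the
`[0,1]_*`-valued logic of `X`. -/
noncomputable def overlap (X : RSet.{u} T) (l m : X → unitInterval) : unitInterval :=
  ⨆ x, T.op (l x) (T.imp (X.eqv x x) (m x))

@[gcongr]
theorem overlap_mono {l' m' : X → unitInterval} (hl : l ≤ l') (hm : m ≤ m') :
    X.overlap l m ≤ X.overlap l' m' :=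
  iSup_mono fun x => op_le_op (hl x) (imp_le_imp_left (hm x))

theorem overlap_comm (hl : X.IsExtensional l) (hm : X.IsExtensional m) :
    X.overlap l m = X.overlap m l :=
  iSup_congr fun x => op_imp_left_comm (hl.le_eqv x) (hm.le_eqv x)

theorem overlap_eqv_left (hl : X.IsExtensional l) (x : X) : X.overlap (X.eqv x) l = l x := by
  refine le_antisymm (iSup_le fun z => ?_) (le_iSup_of_le x ?_)
  · rw [X.eqv_symm]
    exact hl.eqv_op_imp_le z x
  · rw [op_imp_of_le (hl.le_eqv x)]

theorem overlap_eqv_right (hl : X.IsExtensional l) (x : X) : X.overlap l (X.eqv x) = l x := by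
  rw [overlap_comm hl (isExtensional_eqv x), overlap_eqv_left hl]

theorem overlap_eqv_comp_le (f : MonoFun X Y) (y y' : Y) :
    X.overlap (fun x => Y.eqv y (f x)) (fun x => Y.eqv y' (f x)) ≤ Y.eqv y y' := by
  refine iSup_le fun x => ?_
  simpa only [f.extent x, Y.eqv_symm y'] using Y.eqv_op_imp_le y (f x) y'

end Extensional

section Singleton

variable {X : RSet.{u} T} {p : unitInterval} {l m : X → unitInterval}

theorem isSingleton_iff : X.IsSingleton p l ↔ X.IsExtensional l ∧ (∀ x, l x ≤ p) ∧
    (∀ x y, T.op (l y) (T.imp p (l x)) ≤ X.eqv x y) ∧ p ≤ X.overlap l l := by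
  refine ⟨fun h => ⟨⟨fun x => (h.le () x).trans inf_le_right, fun x y => ?_⟩,
    fun x => (h.le () x).trans inf_le_left, h.functional (), h.total () ()⟩,
    fun ⟨hl, hp, functional, total⟩ => ⟨fun _ x => le_inf (hp x) (hl.le_eqv x), fun _ _ x y => ?_,
      fun _ => functional, fun _ _ => total⟩⟩
  · have imp_self : T.imp ((one T p).eqv () ()) ((one T p).eqv () ()) = 1 := imp_eq_one le_rfl
    simpa only [imp_self, T.op_one, T.op_comm (T.imp _ _)] using h.congr () () x y
  · refine (T.op_le_left _ _).trans ?_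
    rw [T.op_comm]
    exact hl.op_imp_le x y

theorem isSingleton_eqv (x : X) : X.IsSingleton (X.eqv x x) (X.eqv x) := by
  refine isSingleton_iff.2 ⟨isExtensional_eqv x, X.eqv_le_left x, fun y z => ?_, ?_⟩
  · rw [X.eqv_symm x y]
    exact X.eqv_trans y x z
  · rw [overlap_eqv_left (isExtensional_eqv x)]

namespace IsSingleton

theorem isExtensional (h : X.IsSingleton p l) : X.IsExtensional l := (isSingleton_iff.1 h).1

theorem le_extent (h : X.IsSingleton p l) (x : X) : l x ≤ p := (isSingleton_iff.1 h).2.1 x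

theorem op_imp_le_eqv (h : X.IsSingleton p l) (x y : X) :
    T.op (l y) (T.imp p (l x)) ≤ X.eqv x y :=
  (isSingleton_iff.1 h).2.2.1 x y

theorem le_overlap_self (h : X.IsSingleton p l) : p ≤ X.overlap l l :=
  (isSingleton_iff.1 h).2.2.2

theorem extent_eq {x : X} (h : X.IsSingleton p (X.eqv x)) : X.eqv x x = p :=
  le_antisymm (h.le_extent x)
    (h.le_overlap_self.trans (overlap_eqv_left (isExtensional_eqv x) x).le)

theorem op_imp_overlap_le (hm : X.IsSingleton p m) (hl : X.IsExtensional l) (x : X) :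
    T.op (m x) (T.imp p (X.overlap m l)) ≤ l x := by
  have overlap_le : X.overlap m l ≤ p :=
    iSup_le fun z => (T.op_le_left _ _).trans (hm.le_extent z)
  rw [op_imp_left_comm (hm.le_extent x) overlap_le, overlap, T.iSup_op]
  refine iSup_le fun z => ?_
  calc T.op (T.op (m z) (T.imp (X.eqv z z) (l z))) (T.imp p (m x))
      = T.op (T.op (m z) (T.imp p (m x))) (T.imp (X.eqv z z) (l z)) := by ac_rfl
    _ ≤ T.op (X.eqv z x) (T.imp (X.eqv z z) (l z)) := by
        gcongr
        exact (hm.op_imp_le_eqv x z).trans_eq (X.eqv_symm x z)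
    _ ≤ l x := hl.eqv_op_imp_le z x

theorem eq_of_le (hl : X.IsSingleton p l) (hm : X.IsSingleton p m) (h : l ≤ m) : l = m := by
  refine le_antisymm h fun x => ?_
  have p_le : p ≤ X.overlap m l := hl.le_overlap_self.trans (overlap_mono h le_rfl)
  simpa only [imp_eq_one p_le, T.op_one] using hm.op_imp_overlap_le hl.isExtensional x

end IsSingleton

end Singleton

namespace MonoFun

variable {X : RSet.{u} T} {Y : RSet.{v} T} {p : unitInterval} {l : X → unitInterval}

/-- The image of the `[0,1]_*`-valued subset `l` under `f`. -/
noncomputable def pushforward (f : MonoFun X Y) (l : X → unitInterval) (y : Y) : unitInterval :=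
  X.overlap l fun x => Y.eqv y (f x)

theorem le_pushforward (f : MonoFun X Y) (l : X → unitInterval) (x : X) :
    l x ≤ f.pushforward l (f x) :=
  le_iSup_of_le x (by rw [imp_eq_one (f.extent x).le, T.op_one])

theorem isSingleton_pushforward (f : MonoFun X Y) (hl : X.IsSingleton p l) :
    Y.IsSingleton p (f.pushforward l) := by
  have preimage_eqv (y : Y) : X.IsExtensional fun x => Y.eqv y (f x) :=
    (isExtensional_eqv y).comp f
  refine isSingleton_iff.2 ⟨?_, fun y => ?_, fun y y' => ?_, ?_⟩
  · have pushforward_eq : f.pushforward l =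
        fun y => ⨆ x, T.op (T.imp (X.eqv x x) (l x)) (Y.eqv (f x) y) := by
      funext y
      rw [pushforward, overlap_comm hl.isExtensional (preimage_eqv y)]
      simp only [overlap, T.op_comm, Y.eqv_symm y]
    rw [pushforward_eq]
    exact .iSup_op _ fun x => isExtensional_eqv (f x)
  · exact iSup_le fun x => (T.op_le_left _ _).trans (hl.le_extent x)
  · rw [pushforward, overlap, T.iSup_op]
    refine (iSup_mono fun x => ?_).trans (overlap_eqv_comp_le f y y')
    calc T.op (T.op (l x) (T.imp (X.eqv x x) (Y.eqv y' (f x)))) (T.imp p (f.pushforward l y))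
        = T.op (T.op (l x) (T.imp p (f.pushforward l y)))
            (T.imp (X.eqv x x) (Y.eqv y' (f x))) := by ac_rfl
      _ ≤ T.op (Y.eqv y (f x)) (T.imp (X.eqv x x) (Y.eqv y' (f x))) := by
          gcongr
          exact hl.op_imp_overlap_le (preimage_eqv y) x
  · refine hl.le_overlap_self.trans (iSup_le fun x => le_iSup_of_le (f x) ?_)
    rw [f.extent x]
    gcongr <;> exact f.le_pushforward l x

end MonoFun

section DenseEmbedding

variable {D : RSet.{v} T} {X : RSet.{u} T} {W : RSet.{w} T} {i : MonoFun D X}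

/-- Dense isometries; density says that each `x` meets its own restriction to `D` fully. -/
structure MonoFun.IsDenseEmbedding (i : MonoFun D X) : Prop where
  eqv_apply : ∀ d d', X.eqv (i d) (i d') = D.eqv d d'
  dense : ∀ x, X.eqv x x ≤ D.overlap (fun d => X.eqv x (i d)) (fun d => X.eqv x (i d))

namespace MonoFun.IsDenseEmbedding

theorem overlap_le {l m : X → unitInterval} (hi : i.IsDenseEmbedding) (hl : X.IsExtensional l)
    (hm : X.IsExtensional m) :
    X.overlap l m ≤ D.overlap (fun d => l (i d)) (fun d => m (i d)) := by
  refine iSup_le fun x => ?_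
  calc T.op (l x) (T.imp (X.eqv x x) (m x))
      = T.op (T.op (X.eqv x x) (T.imp (X.eqv x x) (l x))) (T.imp (X.eqv x x) (m x)) := by
        rw [op_imp_of_le (hl.le_eqv x)]
    _ ≤ T.op (T.op (D.overlap (fun d => X.eqv x (i d)) fun d => X.eqv x (i d))
          (T.imp (X.eqv x x) (l x))) (T.imp (X.eqv x x) (m x)) := by
        gcongr
        exact hi.dense x
    _ ≤ D.overlap (fun d => l (i d)) (fun d => m (i d)) := by
        simp only [overlap, T.iSup_op]
        refine iSup_mono fun d => ?_
        calc _ = T.op (T.op (X.eqv x (i d)) (T.imp (X.eqv x x) (l x)))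
              (T.op (T.imp (D.eqv d d) (X.eqv x (i d))) (T.imp (X.eqv x x) (m x))) := by ac_rfl
          _ ≤ T.op (l (i d)) (T.imp (D.eqv d d) (m (i d))) := by
              gcongr
              · exact hl.eqv_op_imp_le x (i d)
              · exact imp_op_le_imp (hm.eqv_op_imp_le x (i d))

theorem isSingleton_comp {p : unitInterval} {l : X → unitInterval} (hi : i.IsDenseEmbedding)
    (hl : X.IsSingleton p l) : D.IsSingleton p fun d => l (i d) :=
  isSingleton_iff.2 ⟨hl.isExtensional.comp i, fun d => hl.le_extent (i d),
    fun d d' => hi.eqv_apply d d' ▸ hl.op_imp_le_eqv (i d) (i d'),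
    hl.le_overlap_self.trans (hi.overlap_le hl.isExtensional hl.isExtensional)⟩

theorem eqv_le_overlap (hi : i.IsDenseEmbedding) (x x' : X) :
    X.eqv x x' ≤ D.overlap (fun d => X.eqv x (i d)) (fun d => X.eqv x' (i d)) :=
  (overlap_eqv_right (isExtensional_eqv x) x').ge.trans
    (hi.overlap_le (isExtensional_eqv x) (isExtensional_eqv x'))

theorem exists_extension (hi : i.IsDenseEmbedding) (hW : W.IsSeparated)
    (hc : W.IsCauchyComplete) (f : MonoFun D W) : ∃ F : MonoFun X W, ∀ d, F (i d) = f d := by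
  have isSingleton_image (x : X) :
      W.IsSingleton (X.eqv x x) (f.pushforward fun d => X.eqv x (i d)) :=
    f.isSingleton_pushforward (hi.isSingleton_comp (isSingleton_eqv x))
  choose F image_eq using fun x => hc _ _ (isSingleton_image x)
  have extent_eq (x : X) : W.eqv (F x) (F x) = X.eqv x x :=
    (image_eq x ▸ isSingleton_image x).extent_eq
  have eqv_le (x : X) (d : D) : X.eqv x (i d) ≤ W.eqv (F x) (f d) :=
    image_eq x ▸ f.le_pushforward (fun d => X.eqv x (i d)) d
  refine ⟨⟨F, fun x => (extent_eq x).symm, fun x x' => ?_⟩, fun d => ?_⟩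
  · exact (hi.eqv_le_overlap x x').trans
      ((overlap_mono (eqv_le x) (eqv_le x')).trans (overlap_eqv_comp_le f (F x) (F x')))
  · exact hW.eq (extent_eq _) ((f.eqv_apply_self d).trans (i.extent d)) (eqv_le (i d) d)

theorem monoFun_ext (hi : i.IsDenseEmbedding) (hW : W.IsSeparated) {F G : MonoFun X W}
    (h : ∀ d, F (i d) = G (i d)) : F = G := by
  refine MonoFun.ext (funext fun x => hW.eq (F.eqv_apply_self x) (G.eqv_apply_self x) ?_)
  calc X.eqv x x ≤ D.overlap (fun d => X.eqv x (i d)) (fun d => X.eqv x (i d)) := hi.dense x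
    _ ≤ D.overlap (fun d => W.eqv (F x) (F (i d))) (fun d => W.eqv (G x) (F (i d))) := by
        refine overlap_mono (fun d => F.mono x (i d)) fun d => ?_
        rw [h d]
        exact G.mono x (i d)
    _ ≤ W.eqv (F x) (G x) := overlap_eqv_comp_le (i.comp F) (F x) (G x)

end MonoFun.IsDenseEmbedding

end DenseEmbedding

end RSet

namespace RSet

variable {T : ContTNorm}

section Completion

variable {X : RSet.{u} T}

/-- A singleton on `X` bundled with its extent: a point of the Cauchy completion of `X`. -/
@[ext]
structure CauchyPoint (X : RSet.{u} T) where
  /-- the extent of existence -/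
  extent : unitInterval
  /-- the underlying singleton -/
  toFun : X → unitInterval
  isSingleton : X.IsSingleton extent toFun

instance : CoeFun (CauchyPoint X) fun _ => X → unitInterval := ⟨CauchyPoint.toFun⟩

namespace CauchyPoint

theorem overlap_self (s : CauchyPoint X) : X.overlap s s = s.extent :=
  le_antisymm (iSup_le fun x => (T.op_le_left _ _).trans (s.isSingleton.le_extent x))
    s.isSingleton.le_overlap_self

theorem overlap_le_extent (s : CauchyPoint X) (l : X → unitInterval) :
    X.overlap s l ≤ s.extent :=
  iSup_le fun x => (T.op_le_left _ _).trans (s.isSingleton.le_extent x)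

theorem overlap_comm (s t : CauchyPoint X) : X.overlap s t = X.overlap t s :=
  RSet.overlap_comm s.isSingleton.isExtensional t.isSingleton.isExtensional

end CauchyPoint

/-- The Cauchy completion of `X`: its singletons, equal to the degree to which they overlap. -/
noncomputable def completion (X : RSet.{u} T) : RSet.{u} T where
  carrier := CauchyPoint X
  eqv s t := X.overlap s t
  eqv_le s t := by
    rw [s.overlap_self, t.overlap_self]
    exact le_inf (s.overlap_le_extent t) (s.overlap_comm t ▸ t.overlap_le_extent s)
  eqv_symm := CauchyPoint.overlap_comm
  eqv_trans s t r := by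
    rw [t.overlap_self, s.overlap_comm t, overlap, T.iSup_op]
    refine iSup_mono fun x => ?_
    calc T.op (T.op (t x) (T.imp (X.eqv x x) (r x))) (T.imp t.extent (X.overlap t s))
        = T.op (T.op (t x) (T.imp t.extent (X.overlap t s))) (T.imp (X.eqv x x) (r x)) := by
          ac_rfl
      _ ≤ T.op (s x) (T.imp (X.eqv x x) (r x)) := by
          gcongr
          exact t.isSingleton.op_imp_overlap_le s.isSingleton.isExtensional x

/-- The Yoneda embedding of `X` into its Cauchy completion. -/
noncomputable def toCompletion (X : RSet.{u} T) : MonoFun X X.completion where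
  toFun x := ⟨X.eqv x x, X.eqv x, isSingleton_eqv x⟩
  extent x := (overlap_eqv_left (isExtensional_eqv x) x).symm
  mono x y := ((overlap_eqv_left (isExtensional_eqv y) x).trans (X.eqv_symm y x)).ge

theorem completion_eqv_toCompletion (s : X.completion) (x : X) :
    X.completion.eqv s (X.toCompletion x) = s.toFun x :=
  overlap_eqv_right s.isSingleton.isExtensional x

theorem isDenseEmbedding_toCompletion (X : RSet.{u} T) : X.toCompletion.IsDenseEmbedding where
  eqv_apply x := completion_eqv_toCompletion (X.toCompletion x)
  dense s := by
    simp only [completion_eqv_toCompletion]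
    exact le_rfl

theorem isSeparated_completion (X : RSet.{u} T) : X.completion.IsSeparated :=
  isSeparated_iff.2 fun s t h => by
    refine CauchyPoint.ext (s.overlap_self.symm.trans (h.1.trans t.overlap_self))
      (funext fun x => ?_)
    rw [← completion_eqv_toCompletion, h.eqv_eq, completion_eqv_toCompletion]

theorem isCauchyComplete_completion (X : RSet.{u} T) : X.completion.IsCauchyComplete :=
  fun p l hl => by
    let s : X.completion := ⟨p, _, (isDenseEmbedding_toCompletion X).isSingleton_comp hl⟩
    have extent_s : X.completion.eqv s s = p := CauchyPoint.overlap_self s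
    refine ⟨s, (IsSingleton.eq_of_le (extent_s ▸ isSingleton_eqv s) hl fun t => ?_).symm⟩
    calc X.completion.eqv s t
        = X.overlap (fun x => l (X.toCompletion x))
            (fun x => X.completion.eqv t (X.toCompletion x)) := by
          simp only [completion_eqv_toCompletion]
          rfl
      _ ≤ X.completion.overlap l (X.completion.eqv t) := iSup_le fun x => by
          refine le_iSup_of_le (X.toCompletion x) ?_
          rw [X.toCompletion.extent]
      _ = l t := overlap_eqv_right hl.isExtensional t

end Completion

section Prod

variable {X : RSet.{u} T} {Y : RSet.{v} T} {Z : RSet.{w} T}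

/-- The product of `X` and `Y`, which consists of the pairs of elements of equal extent. -/
def prod (X : RSet.{u} T) (Y : RSet.{v} T) : RSet.{max u v} T where
  carrier := {z : X × Y // X.eqv z.1 z.1 = Y.eqv z.2 z.2}
  eqv z z' := X.eqv z.1.1 z'.1.1 ⊓ Y.eqv z.1.2 z'.1.2
  eqv_le z z' := le_inf (inf_le_inf (X.eqv_le_left _ _) (Y.eqv_le_left _ _))
    (inf_le_inf (X.eqv_le_right _ _) (Y.eqv_le_right _ _))
  eqv_symm z z' := by rw [X.eqv_symm, Y.eqv_symm]
  eqv_trans a b c := by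
    rw [← b.2, inf_idem]
    refine le_inf ?_ ?_
    · exact (op_le_op inf_le_left (imp_le_imp_left inf_le_left)).trans (X.eqv_trans _ _ _)
    · rw [b.2]
      exact (op_le_op inf_le_right (imp_le_imp_left inf_le_right)).trans (Y.eqv_trans _ _ _)

theorem prod_eqv_self (z : X.prod Y) : (X.prod Y).eqv z z = X.eqv z.1.1 z.1.1 :=
  inf_eq_left.2 z.2.le

/-- The first projection. -/
def prodFst (X : RSet.{u} T) (Y : RSet.{v} T) : MonoFun (X.prod Y) X where
  toFun z := z.1.1
  extent := prod_eqv_self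
  mono _ _ := inf_le_left

/-- The second projection. -/
def prodSnd (X : RSet.{u} T) (Y : RSet.{v} T) : MonoFun (X.prod Y) Y where
  toFun z := z.1.2
  extent z := (prod_eqv_self z).trans z.2
  mono _ _ := inf_le_right

/-- The monotone function into a product with components `f` and `g`. -/
def prodLift (f : MonoFun Z X) (g : MonoFun Z Y) : MonoFun Z (X.prod Y) where
  toFun z := ⟨(f z, g z), (f.eqv_apply_self z).trans (g.extent z)⟩
  extent z := (le_inf (f.extent z).le (g.extent z).le).antisymm (inf_le_left.trans (f.extent z).ge)
  mono z z' := le_inf (f.mono z z') (g.mono z z')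

/-- The product of two monotone functions. -/
def prodMap {X' : RSet.{u} T} {Y' : RSet.{v} T} (f : MonoFun X X') (g : MonoFun Y Y') :
    MonoFun (X.prod Y) (X'.prod Y') :=
  prodLift ((prodFst X Y).comp f) ((prodSnd X Y).comp g)

theorem IsSeparated.prod (hX : X.IsSeparated) (hY : Y.IsSeparated) : (X.prod Y).IsSeparated :=
  isSeparated_iff.2 fun a b h => by
    have extent_eq : X.eqv a.1.1 a.1.1 = X.eqv b.1.1 b.1.1 := by
      rw [← prod_eqv_self, ← prod_eqv_self, h.1]
    have extent_le : X.eqv b.1.1 b.1.1 ≤ X.eqv a.1.1 b.1.1 ⊓ Y.eqv a.1.2 b.1.2 :=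
      (prod_eqv_self b).ge.trans h.2.le
    exact Subtype.ext (Prod.ext (hX.eq extent_eq rfl (extent_le.trans inf_le_left))
      (hY.eq (a.2.symm.trans extent_eq) b.2.symm (extent_le.trans inf_le_right)))

theorem IsCauchyComplete.prod (hX : X.IsCauchyComplete) (hY : Y.IsCauchyComplete) :
    (X.prod Y).IsCauchyComplete := fun p l hl => by
  have hl₁ := (prodFst X Y).isSingleton_pushforward hl
  have hl₂ := (prodSnd X Y).isSingleton_pushforward hl
  obtain ⟨x, hx⟩ := hX _ _ hl₁
  obtain ⟨y, hy⟩ := hY _ _ hl₂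
  have extent_x : X.eqv x x = p := (hx ▸ hl₁).extent_eq
  have extent_y : Y.eqv y y = p := (hy ▸ hl₂).extent_eq
  let z : X.prod Y := ⟨(x, y), extent_x.trans extent_y.symm⟩
  have extent_z : (X.prod Y).eqv z z = p := (prod_eqv_self z).trans extent_x
  refine ⟨z, hl.eq_of_le (extent_z ▸ isSingleton_eqv z) fun a => le_inf ?_ ?_⟩
  · exact hx ▸ (prodFst X Y).le_pushforward l a
  · exact hy ▸ (prodSnd X Y).le_pushforward l a

end Prod

section Global

variable {A : RSet.{u} T} {B : RSet.{v} T}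

/-- All elements of `A` have full extent of existence. -/
def IsGlobal (A : RSet.{u} T) : Prop := ∀ a, A.eqv a a = 1

theorem IsGlobal.overlap_eq (hA : A.IsGlobal) (l m : A → unitInterval) :
    A.overlap l m = ⨆ a, T.op (l a) (m a) := by
  simp only [overlap, hA _, T.one_imp]

theorem IsGlobal.op_eqv_le (hA : A.IsGlobal) {l : A → unitInterval} (hl : A.IsExtensional l)
    (a a' : A) : T.op (l a) (A.eqv a a') ≤ l a' := by
  simpa only [hA a, T.one_imp] using hl.op_imp_le a a'

/-- The pair of two elements of full extent. -/
def IsGlobal.pair (hA : A.IsGlobal) (hB : B.IsGlobal) (a : A) (b : B) : A.prod B :=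
  ⟨(a, b), (hA a).trans (hB b).symm⟩

theorem IsGlobal.prod (hA : A.IsGlobal) : (A.prod B).IsGlobal :=
  fun z => (prod_eqv_self z).trans (hA _)

/- A point of `X` is approximated by elements of full extent, so its extent is idempotent. Splitting
it as `T.op p p` makes room for an approximation in each of the two coordinates. -/
theorem MonoFun.IsDenseEmbedding.prodMap {X : RSet.{u} T} {Y : RSet.{v} T} {i : MonoFun A X}
    {j : MonoFun B Y} (hi : i.IsDenseEmbedding) (hj : j.IsDenseEmbedding) (hA : A.IsGlobal)
    (hB : B.IsGlobal) : (prodMap i j).IsDenseEmbedding where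
  eqv_apply z z' := congrArg₂ (· ⊓ ·) (hi.eqv_apply _ _) (hj.eqv_apply _ _)
  dense z := by
    let p := X.eqv z.1.1 z.1.1
    let u (a : A) := X.eqv z.1.1 (i a)
    let v (b : B) := Y.eqv z.1.2 (j b)
    have p_le_u : p ≤ ⨆ a, T.op (u a) (u a) := hA.overlap_eq u u ▸ hi.dense z.1.1
    have p_le_v : p ≤ ⨆ b, T.op (v b) (v b) := hB.overlap_eq v v ▸ z.2.le.trans (hj.dense z.1.2)
    have p_le_op_self : p ≤ T.op p p :=
      p_le_u.trans (iSup_le fun a => op_le_op (X.eqv_le_left _ _) (X.eqv_le_left _ _))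
    have op_le_inf (a : A) (b : B) : T.op (u a) (v b) ≤ u a ⊓ v b :=
      le_inf (T.op_le_left _ _) (T.op_le_right _ _)
    calc (X.prod Y).eqv z z = p := prod_eqv_self z
      _ ≤ T.op p p := p_le_op_self
      _ ≤ T.op (⨆ a, T.op (u a) (u a)) (⨆ b, T.op (v b) (v b)) := op_le_op p_le_u p_le_v
      _ = ⨆ a, ⨆ b, T.op (T.op (u a) (v b)) (T.op (u a) (v b)) := by
          simp only [T.iSup_op, T.op_iSup]
          congr! 4
          ac_rfl
      _ ≤ _ := iSup₂_le fun a b => by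
          rw [hA.prod.overlap_eq]
          exact le_iSup_of_le (hA.pair hB a b) (op_le_op (op_le_inf a b) (op_le_inf a b))

end Global

section TestObjects

/-- The one-point set of full extent. -/
def point (T : ContTNorm) : RSet.{u} T where
  carrier := PUnit
  eqv _ _ := 1
  eqv_le _ _ := by rw [inf_idem]
  eqv_symm _ _ := rfl
  eqv_trans _ _ _ := le_top

theorem isGlobal_point : (point.{u} T).IsGlobal := fun _ => rfl

/-- The element `a` of full extent as a monotone function. -/
def IsGlobal.ofPoint {A : RSet.{v} T} (hA : A.IsGlobal) (a : A) : MonoFun (point.{u} T) A where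
  toFun _ := a
  extent _ := (hA a).symm
  mono _ _ := (hA a).ge

/-- The set `S` with any two distinct elements equal to degree `t`. -/
def equidistant (T : ContTNorm) (S : Type u) [DecidableEq S] (t : unitInterval) :
    RSet.{u} T where
  carrier := S
  eqv x y := if x = y then 1 else t
  eqv_le x y := by
    simp only [if_true, inf_idem]
    exact le_top
  eqv_symm x y := by simp only [eq_comm]
  eqv_trans x y z := by
    rw [if_pos rfl, T.one_imp]
    split_ifs with hyz hxy hxz hxz <;> subst_vars
    all_goals
      first | exact le_top | exact T.op_le_left _ _ | exact T.op_le_right _ _ | contradiction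

theorem isGlobal_equidistant (S : Type u) [DecidableEq S] (t : unitInterval) :
    (equidistant T S t).IsGlobal :=
  fun _ => if_pos rfl

/-- The unit interval, two elements being equal to the degree to which they imply each other. -/
noncomputable def line (T : ContTNorm) : RSet.{u} T where
  carrier := ULift unitInterval
  eqv x y := T.imp x.down y.down ⊓ T.imp y.down x.down
  eqv_le x y := by
    simp only [imp_eq_one le_rfl, inf_idem]
    exact le_top
  eqv_symm x y := inf_comm _ _
  eqv_trans x y z := by
    have imp_op_imp (a b c : unitInterval) : T.op (T.imp a b) (T.imp b c) ≤ T.imp a c :=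
      imp_op_le_imp (T.op_imp_le b c)
    rw [imp_eq_one (p := y.down) le_rfl, inf_idem, T.one_imp]
    refine le_inf ?_ ((op_le_op inf_le_right inf_le_right).trans (imp_op_imp _ _ _))
    rw [T.op_comm]
    exact (op_le_op inf_le_left inf_le_left).trans (imp_op_imp _ _ _)

theorem op_line_eqv_le (x y : line.{u} T) : T.op x.down ((line T).eqv x y) ≤ y.down :=
  (op_le_op le_rfl inf_le_left).trans (T.op_imp_le _ _)

/-- An extensional map on `A` as a monotone function. -/
def IsExtensional.toLine {A : RSet.{u} T} {l : A → unitInterval} (hl : A.IsExtensional l)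
    (hA : A.IsGlobal) : MonoFun A (line.{v} T) where
  toFun a := ⟨l a⟩
  extent a := by simp only [line, hA a, imp_eq_one le_rfl, inf_idem]
  mono a a' := le_inf ((T.op_le_iff_le_imp _ _ _).1 (hA.op_eqv_le hl a a'))
    ((T.op_le_iff_le_imp _ _ _).1 (A.eqv_symm a a' ▸ hA.op_eqv_le hl a' a))

end TestObjects

end RSet

namespace ContTNorm.IsMin

variable {T : ContTNorm} {p q r : unitInterval}

theorem op_imp_eq_inf (hT : T.IsMin) (h : q ≤ p) : T.op q (T.imp p r) = q ⊓ r := by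
  refine le_antisymm (le_inf (T.op_le_left _ _) ?_) ?_
  · exact (op_le_op h le_rfl).trans (T.op_imp_le p r)
  · rw [hT]
    exact inf_le_inf_left q ((T.op_le_iff_le_imp p r r).1 (T.op_le_right p r))

end ContTNorm.IsMin

namespace RSet

variable {T : ContTNorm}

section Terminal

/-- The terminal `[0,1]_*`-set, with exactly one element of each extent. -/
def terminal (T : ContTNorm) : RSet.{u} T where
  carrier := ULift unitInterval
  eqv x y := x.down ⊓ y.down
  eqv_le _ _ := by simp
  eqv_symm _ _ := inf_comm _ _
  eqv_trans x y z := by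
    rw [inf_idem]
    refine le_inf ?_ ((T.op_le_left _ _).trans inf_le_right)
    exact (op_le_op inf_le_left le_rfl).trans ((T.op_imp_le _ _).trans inf_le_left)

theorem isSeparated_terminal : (terminal.{u} T).IsSeparated :=
  isSeparated_iff.2 fun x y h => ULift.ext x y (by simpa only [terminal, inf_idem] using h.1)

theorem isCauchyComplete_terminal : (terminal.{u} T).IsCauchyComplete := fun p l hl => by
  let x : terminal.{u} T := ⟨p⟩
  have extent_x : (terminal.{u} T).eqv x x = p := inf_idem p
  refine ⟨x, hl.eq_of_le (extent_x ▸ isSingleton_eqv x) fun y => le_inf (hl.le_extent y) ?_⟩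
  exact (hl.isExtensional.le_eqv y).trans inf_le_left

/-- The monotone function to the terminal object, which sends an element to its extent. -/
def toTerminal (X : RSet.{v} T) : MonoFun X (terminal.{u} T) where
  toFun x := ⟨X.eqv x x⟩
  extent _ := (inf_idem _).symm
  mono := X.eqv_le

theorem eq_toTerminal {X : RSet.{v} T} (f : MonoFun X (terminal.{u} T)) : f = X.toTerminal :=
  MonoFun.ext (funext fun x => ULift.ext _ _ (((f.extent x).trans (inf_idem _)).symm))

end Terminal

section Min

variable {X : RSet.{u} T} {p : unitInterval} {l : X → unitInterval}

theorem eqv_inf_eqv_le (hT : T.IsMin) (X : RSet.{u} T) (x y z : X) :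
    X.eqv x y ⊓ X.eqv y z ≤ X.eqv x z :=
  (hT.op_imp_eq_inf (X.eqv_le_right x y)).ge.trans (X.eqv_op_imp_le x y z)

theorem isSingleton_iff_of_isMin (hT : T.IsMin) : X.IsSingleton p l ↔
    (∀ x, l x ≤ X.eqv x x) ∧ (∀ x y, l x ⊓ X.eqv x y ≤ l y) ∧
      (∀ x y, l x ⊓ l y ≤ X.eqv x y) ∧ ⨆ x, l x = p := by
  rw [isSingleton_iff]
  constructor
  · intro ⟨hl, le_extent, functional, total⟩
    refine ⟨hl.le_eqv, fun x y => ?_, fun x y => ?_, ?_⟩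
    · exact (hT.op_imp_eq_inf (hl.le_eqv x)).ge.trans (hl.op_imp_le x y)
    · rw [inf_comm]
      exact (hT.op_imp_eq_inf (le_extent y)).ge.trans (functional x y)
    · exact le_antisymm (iSup_le le_extent) (total.trans (iSup_mono fun x => T.op_le_left _ _))
  · rintro ⟨le_eqv, inf_le, inf_le_eqv, rfl⟩
    refine ⟨⟨le_eqv, fun x y => ?_⟩, le_iSup l, fun x y => ?_, iSup_mono fun x => ?_⟩
    · exact (hT.op_imp_eq_inf (le_eqv x)).trans_le (inf_le x y)
    · rw [hT.op_imp_eq_inf (le_iSup l y), inf_comm]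
      exact inf_le_eqv x y
    · rw [hT.op_imp_eq_inf (le_eqv x), inf_idem]

theorem exists_restriction (hT : T.IsMin) (hX : X.IsCauchyComplete) (x : X) (p : unitInterval) :
    ∃ r, ∀ y, X.eqv r y = p ⊓ X.eqv x y := by
  suffices X.IsSingleton (p ⊓ X.eqv x x) fun y => p ⊓ X.eqv x y by
    obtain ⟨r, hr⟩ := hX _ _ this
    exact ⟨r, fun y => (congrFun hr y).symm⟩
  refine (isSingleton_iff_of_isMin hT).2
    ⟨fun y => inf_le_right.trans (X.eqv_le_right x y), fun y z => ?_, fun y z => ?_, ?_⟩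
  · rw [inf_assoc]
    exact inf_le_inf_left p (eqv_inf_eqv_le hT X x y z)
  · refine (inf_le_inf inf_le_right inf_le_right).trans ?_
    rw [X.eqv_symm x y]
    exact eqv_inf_eqv_le hT X y x z
  · exact le_antisymm (iSup_le fun y => inf_le_inf_left p (X.eqv_le_left x y))
      (le_iSup (fun y => p ⊓ X.eqv x y) x)

/-- The restriction of an element to a smaller extent. -/
noncomputable def restrict (hT : T.IsMin) (hX : X.IsCauchyComplete) (x : X) (p : unitInterval) :
    X :=
  (exists_restriction hT hX x p).choose

theorem restrict_eqv (hT : T.IsMin) (hX : X.IsCauchyComplete) (x : X) (p : unitInterval) (y : X) :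
    X.eqv (restrict hT hX x p) y = p ⊓ X.eqv x y :=
  (exists_restriction hT hX x p).choose_spec y

theorem restrict_eqv_self (hT : T.IsMin) (hX : X.IsCauchyComplete) (x : X) (p : unitInterval) :
    X.eqv (restrict hT hX x p) (restrict hT hX x p) = p ⊓ X.eqv x x := by
  rw [restrict_eqv, X.eqv_symm, restrict_eqv, ← inf_assoc, inf_idem]

end Min

section Exponential

variable {A : RSet.{u} T} {Y : RSet.{v} T}

/-- A monotone function from the part of `A` of extent at most `extent`, encoded as a function on
all of `A` by precomposition with the restriction to `extent`. -/
@[ext]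
structure PartialFun (A : RSet.{u} T) (Y : RSet.{v} T) where
  /-- the extent of the domain -/
  extent : unitInterval
  /-- the underlying function -/
  toFun : A → Y
  eqv_self : ∀ a, Y.eqv (toFun a) (toFun a) = extent ⊓ A.eqv a a
  mono : ∀ a a', extent ⊓ A.eqv a a' ≤ Y.eqv (toFun a) (toFun a')

namespace PartialFun

instance : CoeFun (PartialFun A Y) fun _ => A → Y := ⟨PartialFun.toFun⟩

/-- The degree to which two partial functions coincide: they do so on all of `A`, and their
domains coincide. -/
noncomputable def eqv (f g : PartialFun A Y) : unitInterval :=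
  f.extent ⊓ g.extent ⊓ ⨅ a, A.eqv a a ⇨ Y.eqv (f a) (g a)

theorem le_eqv_iff {f g : PartialFun A Y} {p : unitInterval} :
    p ≤ f.eqv g ↔ p ≤ f.extent ∧ p ≤ g.extent ∧ ∀ a, p ⊓ A.eqv a a ≤ Y.eqv (f a) (g a) := by
  simp only [eqv, le_inf_iff, le_iInf_iff, le_himp_iff, and_assoc]

theorem eqv_le_left (f g : PartialFun A Y) : f.eqv g ≤ f.extent := (le_eqv_iff.1 le_rfl).1

theorem eqv_le_right (f g : PartialFun A Y) : f.eqv g ≤ g.extent := (le_eqv_iff.1 le_rfl).2.1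

theorem eqv_inf_le (f g : PartialFun A Y) (a : A) : f.eqv g ⊓ A.eqv a a ≤ Y.eqv (f a) (g a) :=
  (le_eqv_iff.1 le_rfl).2.2 a

theorem eqv_eq_extent (f : PartialFun A Y) : f.eqv f = f.extent :=
  le_antisymm (f.eqv_le_left f) (le_eqv_iff.2 ⟨le_rfl, le_rfl, fun a => (f.eqv_self a).ge⟩)

theorem eqv_inf_eqv_le (hT : T.IsMin) (f g : PartialFun A Y) (a a' : A) :
    f.eqv g ⊓ A.eqv a a' ≤ Y.eqv (f a) (g a') :=
  calc f.eqv g ⊓ A.eqv a a' ≤ Y.eqv (f a) (f a') ⊓ Y.eqv (f a') (g a') :=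
        le_inf ((inf_le_inf_right _ (f.eqv_le_left g)).trans (f.mono a a'))
          ((inf_le_inf_left _ (A.eqv_le_right a a')).trans (f.eqv_inf_le g a'))
    _ ≤ Y.eqv (f a) (g a') := RSet.eqv_inf_eqv_le hT Y _ _ _

end PartialFun

/-- The exponential of `A` and `Y` for the minimum t-norm: the set of partial functions. -/
noncomputable def exponential (hT : T.IsMin) (A : RSet.{u} T) (Y : RSet.{v} T) :
    RSet.{max u v} T where
  carrier := PartialFun A Y
  eqv := PartialFun.eqv
  eqv_le f g := by
    rw [f.eqv_eq_extent, g.eqv_eq_extent]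
    exact le_inf (f.eqv_le_left g) (f.eqv_le_right g)
  eqv_symm f g := by simp only [PartialFun.eqv, inf_comm f.extent, Y.eqv_symm]
  eqv_trans f g h := by
    rw [g.eqv_eq_extent, hT.op_imp_eq_inf (g.eqv_le_left h), inf_comm]
    refine PartialFun.le_eqv_iff.2 ⟨inf_le_left.trans (f.eqv_le_left g),
      inf_le_right.trans (g.eqv_le_right h), fun a => ?_⟩
    rw [inf_inf_distrib_right]
    exact (inf_le_inf (f.eqv_inf_le g a) (g.eqv_inf_le h a)).trans (eqv_inf_eqv_le hT Y _ _ _)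

theorem exponential_eqv_self (hT : T.IsMin) (f : exponential hT A Y) :
    (exponential hT A Y).eqv f f = f.extent :=
  f.eqv_eq_extent

theorem isSeparated_exponential (hT : T.IsMin) (hY : Y.IsSeparated) :
    (exponential hT A Y).IsSeparated :=
  isSeparated_iff.2 fun f g h => by
    have extent_eq : f.extent = g.extent := by
      rw [← exponential_eqv_self, ← exponential_eqv_self, h.1]
    have extent_le : g.extent ≤ PartialFun.eqv f g := (exponential_eqv_self hT g).ge.trans h.2.le
    refine PartialFun.ext extent_eq (funext fun a => hY.eq (f.eqv_self a) ?_ ?_)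
    · rw [g.eqv_self, extent_eq]
    · rw [extent_eq]
      exact (inf_le_inf_right _ extent_le).trans (PartialFun.eqv_inf_le f g a)

section CauchyComplete

variable {hT : T.IsMin} {p : unitInterval} {l : exponential hT A Y → unitInterval}

/-- The values at `a` of the members of a `[0,1]_*`-valued set `l` of partial functions. -/
noncomputable def evalAt (l : exponential hT A Y → unitInterval) (a : A) (y : Y) : unitInterval :=
  ⨆ f : PartialFun A Y, l f ⊓ Y.eqv (f a) y

theorem IsExtensional.le_extent (hl : (exponential hT A Y).IsExtensional l)
    (f : PartialFun A Y) : l f ≤ f.extent :=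
  (hl.le_eqv f).trans f.eqv_eq_extent.le

theorem IsSingleton.evalAt (hl : (exponential hT A Y).IsSingleton p l) (a : A) :
    Y.IsSingleton (p ⊓ A.eqv a a) (evalAt l a) := by
  obtain ⟨-, -, inf_le_eqv, iSup_eq⟩ := (isSingleton_iff_of_isMin hT).1 hl
  have eqv_le (f : PartialFun A Y) (y : Y) : Y.eqv (f a) y ≤ A.eqv a a :=
    (Y.eqv_le_left _ _).trans ((f.eqv_self a).trans_le inf_le_right)
  refine (isSingleton_iff_of_isMin hT).2
    ⟨fun y => iSup_le fun f => inf_le_right.trans (Y.eqv_le_right _ _), fun y y' => ?_,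
      fun y y' => ?_, le_antisymm ?_ ?_⟩
  · rw [RSet.evalAt, iSup_inf_eq]
    refine iSup_mono fun f => ?_
    rw [inf_assoc]
    exact inf_le_inf_left _ (eqv_inf_eqv_le hT Y _ _ _)
  · simp only [RSet.evalAt, iSup_inf_iSup]
    refine iSup_le fun ⟨f, g⟩ => ?_
    calc l f ⊓ Y.eqv (f a) y ⊓ (l g ⊓ Y.eqv (g a) y')
        ≤ Y.eqv y (f a) ⊓ Y.eqv (f a) (g a) ⊓ Y.eqv (g a) y' := by
          rw [inf_inf_inf_comm, ← inf_assoc, Y.eqv_symm y]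
          refine inf_le_inf_right _ (le_inf inf_le_right ?_)
          exact (inf_le_inf (inf_le_eqv f g) (eqv_le f y)).trans (f.eqv_inf_le g a)
      _ ≤ Y.eqv y (g a) ⊓ Y.eqv (g a) y' := inf_le_inf_right _ (eqv_inf_eqv_le hT Y _ _ _)
      _ ≤ Y.eqv y y' := eqv_inf_eqv_le hT Y _ _ _
  · exact iSup_le fun y => iSup_le fun f => inf_le_inf (hl.le_extent f) (eqv_le f y)
  · rw [← iSup_eq, iSup_inf_eq]
    refine iSup_le fun f => le_iSup_of_le (f.toFun a) (le_iSup_of_le f ?_)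
    rw [f.eqv_self]
    exact le_inf inf_le_left (inf_le_inf_right _ (hl.isExtensional.le_extent f))

theorem isCauchyComplete_exponential (hT : T.IsMin) (hY : Y.IsCauchyComplete) :
    (exponential hT A Y).IsCauchyComplete := fun p l hl => by
  choose F evalAt_eq using fun a => hY _ _ (hl.evalAt a)
  have inf_le_eqv (f : PartialFun A Y) (a a' : A) : l f ⊓ A.eqv a a' ≤ Y.eqv (F a) (f a') := by
    rw [← evalAt_eq a]
    exact le_iSup_of_le f (le_inf inf_le_left
      ((inf_le_inf_right _ (hl.isExtensional.le_extent f)).trans (f.mono a a')))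
  let φ : exponential hT A Y :=
    { extent := p
      toFun := F
      eqv_self := fun a => (evalAt_eq a ▸ hl.evalAt a).extent_eq
      mono := fun a a' => by
        rw [← ((isSingleton_iff_of_isMin hT).1 hl).2.2.2, iSup_inf_eq]
        refine iSup_le fun f => ?_
        calc l f ⊓ A.eqv a a' ≤ Y.eqv (F a) (f.toFun a') ⊓ Y.eqv (f.toFun a') (F a') := by
              rw [Y.eqv_symm (f.toFun a')]
              exact le_inf (inf_le_eqv f a a')
                ((inf_le_inf_left _ (A.eqv_le_right a a')).trans (inf_le_eqv f a' a'))
          _ ≤ Y.eqv (F a) (F a') := eqv_inf_eqv_le hT Y _ _ _ }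
  have extent_φ : (exponential hT A Y).eqv φ φ = p := exponential_eqv_self hT φ
  refine ⟨φ, hl.eq_of_le (extent_φ ▸ isSingleton_eqv φ) fun f => ?_⟩
  exact PartialFun.le_eqv_iff.2
    ⟨hl.le_extent f, hl.isExtensional.le_extent f, fun a => inf_le_eqv f a a⟩

end CauchyComplete

end Exponential

section Curry

variable {A : RSet.{u} T} {X : RSet.{v} T} {Y : RSet.{w} T}

/-- The pair of the restrictions of `a` and `x` to their common extent. -/
noncomputable def restrictPair (hT : T.IsMin) (hA : A.IsCauchyComplete) (hX : X.IsCauchyComplete)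
    (a : A) (x : X) : A.prod X :=
  ⟨(restrict hT hA a (X.eqv x x), restrict hT hX x (A.eqv a a)), by
    rw [restrict_eqv_self, restrict_eqv_self, inf_comm]⟩

theorem restrictPair_eqv (hT : T.IsMin) (hA : A.IsCauchyComplete) (hX : X.IsCauchyComplete)
    (a a' : A) (x x' : X) :
    A.eqv (restrictPair hT hA hX a x).1.1 a' ⊓ X.eqv (restrictPair hT hA hX a x).1.2 x' =
      A.eqv a a' ⊓ X.eqv x x' := by
  simp only [restrictPair, restrict_eqv]
  exact (inf_le_inf inf_le_right inf_le_right).antisymm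
    (le_inf (le_inf (inf_le_right.trans (X.eqv_le_left x x')) inf_le_left)
      (le_inf (inf_le_left.trans (A.eqv_le_left a a')) inf_le_right))

theorem restrictPair_eqv_restrictPair (hT : T.IsMin) (hA : A.IsCauchyComplete)
    (hX : X.IsCauchyComplete) (a a' : A) (x x' : X) :
    (A.prod X).eqv (restrictPair hT hA hX a x) (restrictPair hT hA hX a' x') =
      A.eqv a a' ⊓ X.eqv x x' := by
  refine (restrictPair_eqv hT hA hX a _ x _).trans ?_
  rw [A.eqv_symm, X.eqv_symm, restrictPair_eqv, A.eqv_symm, X.eqv_symm]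

/-- The exponential transpose of `φ`, evaluated at `x`. -/
noncomputable def curryAt (hT : T.IsMin) (hA : A.IsCauchyComplete) (hX : X.IsCauchyComplete)
    (φ : MonoFun (A.prod X) Y) (x : X) : PartialFun A Y where
  extent := X.eqv x x
  toFun a := φ (restrictPair hT hA hX a x)
  eqv_self a := by rw [φ.eqv_apply_self, restrictPair_eqv_restrictPair, inf_comm]
  mono a a' := by
    rw [inf_comm, ← restrictPair_eqv_restrictPair hT hA hX]
    exact φ.mono _ _

/-- The exponential transpose of `φ`. -/
noncomputable def curry (hT : T.IsMin) (hA : A.IsCauchyComplete) (hX : X.IsCauchyComplete)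
    (φ : MonoFun (A.prod X) Y) : MonoFun X (exponential hT A Y) where
  toFun := curryAt hT hA hX φ
  extent x := (exponential_eqv_self hT (curryAt hT hA hX φ x)).symm
  mono x x' := PartialFun.le_eqv_iff.2 ⟨X.eqv_le_left x x', X.eqv_le_right x x', fun a => by
    rw [inf_comm, ← restrictPair_eqv_restrictPair hT hA hX]
    exact φ.mono _ _⟩

section Uncurry

variable {hT : T.IsMin} (ψ : MonoFun X (exponential hT A Y))

theorem MonoFun.extent_apply (x : X) : (ψ x).extent = X.eqv x x :=
  (exponential_eqv_self hT (ψ x)).symm.trans (ψ.eqv_apply_self x)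

theorem MonoFun.inf_le_eqv_apply (a a' : A) (x x' : X) :
    A.eqv a a' ⊓ X.eqv x x' ≤ Y.eqv ((ψ x).toFun a) ((ψ x').toFun a') := by
  rw [inf_comm]
  exact (inf_le_inf_right _ (ψ.mono x x')).trans (PartialFun.eqv_inf_eqv_le hT _ _ a a')

theorem MonoFun.eqv_apply_apply_self (a : A) (x : X) :
    Y.eqv ((ψ x).toFun a) ((ψ x).toFun a) = A.eqv a a ⊓ X.eqv x x := by
  rw [inf_comm, ← ψ.extent_apply]
  exact PartialFun.eqv_self (ψ x) a

/-- The monotone function in two variables whose exponential transpose is `ψ`. -/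
def uncurry : MonoFun (A.prod X) Y where
  toFun z := (ψ z.1.2).toFun z.1.1
  extent z := (ψ.eqv_apply_apply_self z.1.1 z.1.2).symm
  mono z z' := ψ.inf_le_eqv_apply z.1.1 z'.1.1 z.1.2 z'.1.2

end Uncurry

theorem uncurry_curry (hT : T.IsMin) (hA : A.IsCauchyComplete) (hX : X.IsCauchyComplete)
    (hY : Y.IsSeparated) (φ : MonoFun (A.prod X) Y) : uncurry (curry hT hA hX φ) = φ :=
  MonoFun.ext <| funext fun z => by
    let r := restrictPair hT hA hX z.1.1 z.1.2
    refine hY.eq ((uncurry (curry hT hA hX φ)).eqv_apply_self z) (φ.eqv_apply_self z) ?_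
    calc (A.prod X).eqv z z = (A.prod X).eqv r z := (restrictPair_eqv hT hA hX _ _ _ _).symm
      _ ≤ Y.eqv (φ r) (φ z) := φ.mono r z

theorem curry_uncurry {hT : T.IsMin} (hA : A.IsCauchyComplete) (hX : X.IsCauchyComplete)
    (hY : Y.IsSeparated) (ψ : MonoFun X (exponential hT A Y)) :
    curry hT hA hX (uncurry ψ) = ψ :=
  MonoFun.ext <| funext fun x =>
    PartialFun.ext (ψ.extent_apply x).symm <| funext fun a => by
      let r := restrictPair hT hA hX a x
      refine hY.eq (p := A.eqv a a ⊓ X.eqv x x) ?_ (ψ.eqv_apply_apply_self a x) ?_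
      · exact ((uncurry ψ).eqv_apply_self r).trans (restrictPair_eqv_restrictPair hT hA hX a a x x)
      · calc A.eqv a a ⊓ X.eqv x x = A.eqv r.1.1 a ⊓ X.eqv r.1.2 x :=
              (restrictPair_eqv hT hA hX a a x x).symm
          _ ≤ Y.eqv ((ψ r.1.2).toFun r.1.1) ((ψ x).toFun a) := ψ.inf_le_eqv_apply _ _ _ _

end Curry

end RSet

section CartesianClosed

open MonoidalCategory

theorem isCartesianClosed_iff {C : Type u} [Category.{v} C] [CartesianMonoidalCategory C] :
    IsCartesianClosed C ↔ ∀ X : C, (tensorLeft X).IsLeftAdjoint where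
  mp h X := by
    let iso := CartesianMonoidalCategory.tensorLeftIsoProd X
    obtain ⟨_, ⟨_⟩⟩ := h
    have : (Limits.prod.functor.obj X).IsLeftAdjoint :=
      CartesianMonoidalCategory.isLeftAdjoint_prod_functor X
    exact Functor.isLeftAdjoint_of_iso iso.symm
  mpr h := ⟨‹_›, ⟨⟨fun X => ⟨(tensorLeft X).rightAdjoint, Adjunction.ofIsLeftAdjoint _⟩⟩⟩⟩

end CartesianClosed

namespace CcRSet

open RSet MonoidalCategory

variable {T : ContTNorm}

instance (X Y : CcRSet.{u} T) : CoeFun (X ⟶ Y) fun _ => X.obj → Y.obj := ⟨fun f => f.hom.toFun⟩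

theorem hom_ext {X Y : CcRSet.{u} T} {f g : X ⟶ Y} (h : ∀ x, f x = g x) : f = g :=
  ObjectProperty.hom_ext _ (MonoFun.ext (funext h))

/-- The cartesian structure given by the terminal `[0,1]_*`-set and the product of pairs of equal
extent. -/
instance : CartesianMonoidalCategory (CcRSet.{u} T) :=
  .ofChosenFiniteProducts
    ⟨Limits.asEmptyCone ⟨terminal T, isSeparated_terminal, isCauchyComplete_terminal⟩,
      Limits.IsTerminal.ofUniqueHom (fun X => ObjectProperty.homMk X.obj.toTerminal)
        fun _ f => ObjectProperty.hom_ext _ (eq_toTerminal f.hom)⟩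
    fun X Y =>
      ⟨Limits.BinaryFan.mk
          (P := ⟨X.obj.prod Y.obj, X.property.1.prod Y.property.1, X.property.2.prod Y.property.2⟩)
          (ObjectProperty.homMk (prodFst X.obj Y.obj)) (ObjectProperty.homMk (prodSnd X.obj Y.obj)),
        Limits.BinaryFan.isLimitMk
          (fun s => ObjectProperty.homMk (prodLift s.fst.hom s.snd.hom))
          (fun _ => rfl) (fun _ => rfl) fun s _ hfst hsnd =>
            hom_ext fun z => Subtype.ext (Prod.ext (congrArg (fun k : s.pt ⟶ X => k z) hfst)
              (congrArg (fun k : s.pt ⟶ Y => k z) hsnd))⟩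

section Gluing

/-- The transposes of `G` and `H` agree at `c x`, and transitivity in the exponential through their
common value there compares `G` with `H`. -/
theorem inf_op_imp_le_of_whiskerLeft_comp_eq {A B C W : CcRSet.{u} T}
    [(tensorLeft B).IsLeftAdjoint] (c : C ⟶ A) (G H : B ⊗ A ⟶ W) (hGH : B ◁ c ≫ G = B ◁ c ≫ H)
    (x : C.obj) (v w : B.obj.prod A.obj) :
    B.obj.eqv v.1.1 w.1.1 ⊓
      T.op (A.obj.eqv v.1.2 (c x)) (T.imp (A.obj.eqv (c x) (c x)) (A.obj.eqv (c x) w.1.2)) ≤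
        W.obj.eqv (G v) (H w) := by
  let adj := Adjunction.ofIsLeftAdjoint (tensorLeft B)
  let E := (tensorLeft B).rightAdjoint.obj W
  let g : A ⟶ E := adj.homEquiv A W G
  let h : A ⟶ E := adj.homEquiv A W H
  have comp_eq : c ≫ g = c ≫ h := by
    simp only [g, h, ← Adjunction.homEquiv_naturality_left]
    exact congrArg (adj.homEquiv C W) hGH
  have apply_eq : g (c x) = h (c x) := congrArg (fun k : C ⟶ E => k x) comp_eq
  let ev : B ⊗ E ⟶ W := adj.counit.app W
  have whiskerLeft_ev (K : B ⊗ A ⟶ W) : B ◁ adj.homEquiv A W K ≫ ev = K :=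
    (adj.homEquiv_counit ..).symm.trans ((adj.homEquiv A W).symm_apply_apply K)
  have le_E : T.op (A.obj.eqv v.1.2 (c x))
      (T.imp (A.obj.eqv (c x) (c x)) (A.obj.eqv (c x) w.1.2)) ≤
        E.obj.eqv (g v.1.2) (h w.1.2) := by
    rw [g.hom.extent (c x)]
    refine (op_le_op (g.hom.mono _ _) (imp_le_imp_left ((h.hom.mono _ _).trans_eq ?_))).trans
      (E.obj.eqv_op_imp_le (g v.1.2) (g (c x)) (h w.1.2))
    exact congrArg (fun e => E.obj.eqv e (h w.1.2)) apply_eq.symm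
  rw [← whiskerLeft_ev G, ← whiskerLeft_ev H]
  exact (inf_le_inf_left _ le_E).trans (ev.hom.mono ((B ◁ g) v) ((B ◁ h) w))

/-- The Cauchy completion as an object of `CcRSet T`. -/
noncomputable def completion (X : RSet.{u} T) : CcRSet.{u} T :=
  ⟨X.completion, isSeparated_completion X, isCauchyComplete_completion X⟩

variable {A B W : RSet.{u} T} [(tensorLeft (completion B)).IsLeftAdjoint]

theorem inf_op_le_of_eqOn (hA : A.IsGlobal) (hB : B.IsGlobal) (G H : MonoFun (B.prod A) W) (x : A)
    (hGH : ∀ v, v.1.2 = x → G v = H v) (v w : B.prod A) :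
    B.eqv v.1.1 w.1.1 ⊓ T.op (A.eqv v.1.2 x) (A.eqv x w.1.2) ≤ W.eqv (G v) (H w) := by
  let i := toCompletion A
  let j := toCompletion B
  let k := toCompletion (point.{u} T)
  have hi : i.IsDenseEmbedding := isDenseEmbedding_toCompletion A
  have hj : j.IsDenseEmbedding := isDenseEmbedding_toCompletion B
  have hk : k.IsDenseEmbedding := isDenseEmbedding_toCompletion (point T)
  have exists_extension (F : MonoFun (B.prod A) W) :
      ∃ F' : MonoFun (B.completion.prod A.completion) W.completion,
        ∀ v, F' (prodMap j i v) = W.toCompletion (F v) :=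
    (hj.prodMap hi hB hA).exists_extension (isSeparated_completion W)
      (isCauchyComplete_completion W) (F.comp W.toCompletion)
  obtain ⟨G', hG'⟩ := exists_extension G
  obtain ⟨H', hH'⟩ := exists_extension H
  obtain ⟨c, hc⟩ := hk.exists_extension (isSeparated_completion A)
    (isCauchyComplete_completion A) ((hA.ofPoint x).comp i)
  have comp_eq : (prodMap (.id B.completion) c).comp G' = (prodMap (.id _) c).comp H' := by
    refine (hj.prodMap hk hB isGlobal_point).monoFun_ext (isSeparated_completion W) fun d => ?_
    let v : B.prod A := hB.pair hA d.1.1 x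
    have apply_eq : prodMap (.id _) c (prodMap j k d) = prodMap j i v :=
      Subtype.ext (Prod.ext rfl (hc d.1.2))
    change G' (prodMap (.id _) c (prodMap j k d)) = H' (prodMap (.id _) c (prodMap j k d))
    rw [apply_eq, hG', hH', hGH v rfl]
  have key := inf_op_imp_le_of_whiskerLeft_comp_eq (B := completion B) (A := completion A)
    (C := completion (point T)) (W := completion W) (ObjectProperty.homMk c)
    (ObjectProperty.homMk G') (ObjectProperty.homMk H')
    (ObjectProperty.hom_ext _ comp_eq) (k ⟨⟩) (prodMap j i v) (prodMap j i w)
  calc B.eqv v.1.1 w.1.1 ⊓ T.op (A.eqv v.1.2 x) (A.eqv x w.1.2)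
      = B.completion.eqv (j v.1.1) (j w.1.1) ⊓ T.op (A.completion.eqv (i v.1.2) (i x))
          (T.imp (A.completion.eqv (i x) (i x)) (A.completion.eqv (i x) (i w.1.2))) := by
        simp only [hi.eqv_apply, hj.eqv_apply, hA x, T.one_imp]
    _ ≤ W.completion.eqv (G' (prodMap j i v)) (H' (prodMap j i w)) := by
        rw [← show c (k ⟨⟩) = i x from hc ⟨⟩]
        exact key
    _ = W.eqv (G v) (H w) := by rw [hG', hH', (isDenseEmbedding_toCompletion W).eqv_apply]

theorem inf_op_le_iSup_op (hA : A.IsGlobal) (hB : B.IsGlobal) (b b' : B) (a x a' : A) :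
    B.eqv b b' ⊓ T.op (A.eqv a x) (A.eqv x a') ≤
      ⨆ c, T.op (B.eqv b c ⊓ A.eqv a x) (B.eqv c b' ⊓ A.eqv x a') := by
  let P := B.prod A
  let u : P := hB.pair hA b a
  let y (c : B) : P := hB.pair hA c x
  have hP : P.IsGlobal := hB.prod
  let g (v : P) : unitInterval := P.eqv u v
  let h (v : P) : unitInterval := ⨆ c, T.op (g (y c)) (P.eqv (y c) v)
  have hg : P.IsExtensional g := isExtensional_eqv u
  have hh : P.IsExtensional h := .iSup_op _ fun c => isExtensional_eqv (y c)
  have agree (v : P) (hv : v.1.2 = x) : g v = h v := by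
    obtain ⟨c, rfl⟩ : ∃ c, v = y c := ⟨v.1.1, Subtype.ext (Prod.ext rfl hv)⟩
    refine le_antisymm (le_iSup_of_le c ?_) (iSup_le fun d => hP.op_eqv_le hg _ _)
    rw [hP, T.op_one]
  let G := hg.toLine hP
  let H := hh.toLine hP
  let w : P := hB.pair hA b' a'
  calc B.eqv b b' ⊓ T.op (A.eqv a x) (A.eqv x a')
      ≤ (line.{u} T).eqv (G u) (H w) :=
        inf_op_le_of_eqOn hA hB G H x (fun v hv => ULift.ext _ _ (agree v hv)) u w
    _ = T.op (g u) ((line.{u} T).eqv (G u) (H w)) := by rw [show g u = 1 from hP u, T.one_op]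
    _ ≤ h w := op_line_eqv_le (G u) (H w)

end Gluing

theorem isMin_of_isLeftAdjoint_tensorLeft
    (h : ∀ X : CcRSet.{u} T, (tensorLeft X).IsLeftAdjoint) : T.IsMin :=
  isMin_of_op_self_le fun t => by
    let S := ULift.{u} Bool
    let A := equidistant T S t
    let B := equidistant T S (T.op t t)
    calc T.op t t ≤ B.eqv ⟨false⟩ ⟨true⟩ ⊓ T.op (A.eqv ⟨false⟩ ⟨true⟩) (A.eqv ⟨true⟩ ⟨false⟩) :=
          le_inf le_rfl le_rfl
      _ ≤ ⨆ c, T.op (B.eqv ⟨false⟩ c ⊓ A.eqv ⟨false⟩ ⟨true⟩)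
            (B.eqv c ⟨true⟩ ⊓ A.eqv ⟨true⟩ ⟨false⟩) :=
          inf_op_le_iSup_op (isGlobal_equidistant S t) (isGlobal_equidistant S (T.op t t)) ..
      _ ≤ T.op t (T.op t t) := iSup_le fun ⟨c⟩ => by
          cases c
          case false => exact op_le_op inf_le_right inf_le_left
          case true => exact (op_le_op inf_le_left inf_le_right).trans (T.op_comm _ _).le

section Exponential

/-- The exponential as an object of `CcRSet T`. -/
noncomputable def exponential (hT : T.IsMin) (A Y : CcRSet.{u} T) : CcRSet.{u} T :=
  ⟨RSet.exponential hT A.obj Y.obj, isSeparated_exponential hT Y.property.1,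
    isCauchyComplete_exponential hT Y.property.2⟩

/-- The hom-set bijection of the exponential adjunction. -/
noncomputable def tensorHomEquiv (hT : T.IsMin) (A X Y : CcRSet.{u} T) :
    (A ⊗ X ⟶ Y) ≃ (X ⟶ exponential hT A Y) where
  toFun φ := ObjectProperty.homMk (RSet.curry hT A.property.2 X.property.2 φ.hom)
  invFun ψ := ObjectProperty.homMk (RSet.uncurry (hT := hT) ψ.hom)
  left_inv φ := ObjectProperty.hom_ext _
    (RSet.uncurry_curry hT A.property.2 X.property.2 Y.property.1 φ.hom)
  right_inv ψ := ObjectProperty.hom_ext _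
    (RSet.curry_uncurry A.property.2 X.property.2 Y.property.1 ψ.hom)

theorem tensorHomEquiv_symm_naturality (hT : T.IsMin) {A X X' Y : CcRSet.{u} T} (f : X' ⟶ X)
    (ψ : X ⟶ exponential hT A Y) :
    (tensorHomEquiv hT A X' Y).symm (f ≫ ψ) = A ◁ f ≫ (tensorHomEquiv hT A X Y).symm ψ :=
  rfl

theorem isLeftAdjoint_tensorLeft (hT : T.IsMin) (A : CcRSet.{u} T) :
    (tensorLeft A).IsLeftAdjoint :=
  (Adjunction.adjunctionOfEquivRight (F := tensorLeft A) (tensorHomEquiv hT A)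
    fun X' X Y f φ => by
      rw [← Equiv.eq_symm_apply, tensorHomEquiv_symm_naturality, Equiv.symm_apply_apply]
      rfl).isLeftAdjoint

end Exponential

end CcRSet

theorem mainTheorem2 (T : ContTNorm) :
    IsCartesianClosed (CcRSet.{u} T) ↔ T.IsMin := by
  rw [isCartesianClosed_iff]
  exact ⟨CcRSet.isMin_of_isLeftAdjoint_tensorLeft, CcRSet.isLeftAdjoint_tensorLeft⟩
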